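/- **Deep sparse coding without noise.** Let $J\ge 0$, let $d_0,\dots,d_J\ge 1$ be integers, let $\mathbf D_j\in\mathbb R^{d_{j-1}\times d_j}$, $j=1,\dots,J$, be dictionaries whose columns have Euclidean norm one, and let $\boldsymbol\lambda\in[0,\infty)^J$ satisfy $\lambda_j<\frac12\bigl(1+\frac1{\mu(\mathbf D_j)}\bigr)$ for all $j$, where $\mu(\mathbf D)=\max_{i\ne k}\frac{|\mathbf d_i^\top\mathbf d_k|}{\|\mathbf d_i\|_2\|\mathbf d_k\|_2}$ is the mutual coherence ($\mu=0$ if there is only one column, and $1/0=\infty$). For $B\in\mathbb R$ let $\mathcal Y_B$ be the set of all $(\mathbf y,\mathbf x_1,\dots,\mathbf x_J)$ with $\mathbf y\in\mathbb R^{d_0}$, $\mathbf x_j\in\mathbb R^{d_j}$, $\mathbf y=\mathbf D_1\mathbf x_1$, $\mathbf x_{j-1}=\mathbf D_j\mathbf x_j$ for $2\le j\le J$, and $\|\mathbf x_j\|_0\le\lambda_j$, $\|\mathbf x_j\|_\infty\le B$ for $1\le j\le J$. A *CNN with kernel size $s$* on $\mathbb R^{d_0}$ is a multi-channel one-dimensional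 convolutional network: starting from one channel $\mathbf y$, each hidden layer maps channels $(\mathbf h_i)_{i\le n}$ of dimension $p$ to channels $\sigma\bigl(\sum_{i}\mathbf w_{\ell,i}*_t\mathbf h_i+b_\ell\mathbf 1\bigr)$, $\ell\le n'$, of dimension $\lceil p/t\rceil$, where $n',t\ge 1$ may depend on the layer, $\mathbf w_{\ell,i}\in\mathbb R^s$, $b_\ell\in\mathbb R$, $\sigma(u)=\max\{u,0\}$ and $(\mathbf w*_t\mathbf h)_i=\sum_{k=1}^s w_k h_{(i-1)t+k}$ with $\mathbf h$ continued by zero; when all channels of a layer have dimension one they may be regarded as one vector with a single channel. The outputs $\tilde{\mathbf x}_1(\mathbf y),\dots,\tilde{\mathbf x}_J(\mathbf y)$, $\tilde{\mathbf x}_j(\mathbf y)\in\mathbb R^{d_j}$, are read off, in this order along the depth, from hidden layers of the network by convolutional layers of kernel size $s$ without activation, with $d_j$ channels of dimension one. The depth counts all convolutional layers, those of the outputs included; weights are filter entries and biases, of the outputs as well. There are an absolute constant $A>0$, a constant $c>0$ depending only on $\mathbf D=(\mathbf D_j)_j$ and $\boldsymbol\lambda$, and constants $C,C'>0$ depending only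 on $\mathbf D,B,\boldsymbol\lambda$, such that for every integer $s\ge2$: 1. For every integer $K\ge1$ there is a CNN with kernel size $s$, with depth at most $A\,K\log_s\prod_{j=1}^J\max\{s,d_{j-1}+d_j\}$, with at most $A\,K\prod_{j=1}^J(d_{j-1}+d_j)^2$ non-zero weights and at most $A\,s\,K\prod_{j=1}^J(d_{j-1}+d_j)^2$ weights in all, such that, for all $(\mathbf y,\mathbf x_1,\dots,\mathbf x_J)\in\mathcal Y_B$ and all $1\le j\le J$, $$\|\tilde{\mathbf x}_j(\mathbf y)-\mathbf x_j\|_2\le C e^{-cK}.$$ 2. For every $0<\varepsilon\le\frac12$ there is a CNN with kernel size $s$ and depth at most $C'\,|\log_2\varepsilon|$ such that $\|\tilde{\mathbf x}_j(\mathbf y)-\mathbf x_j\|_2\le\varepsilon$ for all $(\mathbf y,\mathbf x_1,\dots,\mathbf x_J)\in\mathcal Y_B$ and all $1\le j\le J$. -/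

import Mathlib

/-- The Euclidean norm of a real vector. -/
noncomputable def l2norm {m : ℕ} (v : Fin m → ℝ) : ℝ :=
  ‖(WithLp.toLp 2 v : EuclideanSpace ℝ (Fin m))‖

/-- Every column of `A` has Euclidean norm one. -/
def ColumnNormalized {m n : ℕ} (A : Matrix (Fin m) (Fin n) ℝ) : Prop :=
  ∀ j, l2norm (fun i => A i j) = 1

/-- The mutual coherence of `A`: the maximum over pairs of distinct columns of the absolute
cosine of their angle. (If `A` has at most one column, the maximum is over the empty set and the
value is `0`.) -/
noncomputable def mutualCoherence {m n : ℕ} (A : Matrix (Fin m) (Fin n) ℝ) : ℝ :=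
  ⨆ p : {p : Fin n × Fin n // p.1 ≠ p.2},
    |∑ i, A i p.1.1 * A i p.1.2| /
      (l2norm (fun i => A i p.1.1) * l2norm (fun i => A i p.1.2))

/-- The sparsity condition `lam < (1 + 1 / μ(A)) / 2`, where `1 / 0 = ∞`, so that the condition is
void when `μ(A) = 0`. -/
def SparsityCondition {m n : ℕ} (A : Matrix (Fin m) (Fin n) ℝ) (lam : ℝ) : Prop :=
  0 < mutualCoherence A → lam < (1 / 2) * (1 + 1 / mutualCoherence A)

/-- `x 1, …, x J` is a solution of the deep sparse coding problem for the observation `y`, the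
dictionaries `D`, the sparsity levels `lam` and the tolerances `eps`. The family `x` is prolonged
by `x 0 = y`. The matrix `D j`, `j : Fin J`, links layer `j.castSucc` to layer `j.succ`, and
`hammingNorm` is the number of non-zero entries. -/
structure IsDSCSolution {J : ℕ} {d : Fin (J + 1) → ℕ}
    (D : ∀ j : Fin J, Matrix (Fin (d j.castSucc)) (Fin (d j.succ)) ℝ)
    (lam eps : Fin J → ℝ) (y : Fin (d 0) → ℝ) (x : ∀ j : Fin (J + 1), Fin (d j) → ℝ) : Prop where
  observation : x 0 = y
  fidelity : ∀ j : Fin J, l2norm (x j.castSucc - (D j).mulVec (x j.succ)) ≤ eps j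
  sparsity : ∀ j : Fin J, (hammingNorm (x j.succ) : ℝ) ≤ lam j

/-- The `i`-th entry (counted from `0`) of the convolution of size `s` and stride `t` of the filter
`w` with the signal `x`, where `x` is continued by zero. -/
noncomputable def convEntry {s p : ℕ} (t : ℕ) (w : Fin s → ℝ) (x : Fin p → ℝ) (i : ℕ) : ℝ :=
  ∑ k : Fin s, w k * (if h : i * t + (k : ℕ) < p then x ⟨i * t + (k : ℕ), h⟩ else 0)

/-- Multi-channel one-dimensional convolutional ReLU networks of filter size `s` on inputs of
dimension `d 0`, with intermediate outputs. A term of `CNN s d j p n` is a network whose last hidden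
layer has `n` channels of dimension `p`, and to which outputs of dimensions `d 1, …, d j` have been
attached, in this order, along its depth. -/
inductive CNN (s : ℕ) {J : ℕ} (d : Fin (J + 1) → ℕ) : Fin (J + 1) → ℕ → ℕ → Type
  /-- The input, one channel of dimension `d 0`. -/
  | input : CNN s d 0 (d 0) 1
  /-- A convolutional layer with stride `t`, `n'` channels, filters `w`, one bias per channel, and
  ReLU activation; `q = ⌈p / t⌉` is the new dimension. -/
  | conv {j : Fin (J + 1)} {p n : ℕ} (Φ : CNN s d j p n) (t : ℕ) (ht : 1 ≤ t)
      (q : ℕ) (hq : q = p ⌈/⌉ t) (n' : ℕ) (hn' : 1 ≤ n')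
      (w : Fin n' → Fin n → Fin s → ℝ) (b : Fin n' → ℝ) : CNN s d j q n'
  /-- Channels of dimension one are regarded as one vector with a single channel. -/
  | flatten {j : Fin (J + 1)} {p n : ℕ} (Φ : CNN s d j p n) (hp : p = 1) : CNN s d j n 1
  /-- An intermediate output: a convolutional layer without activation which is read off the current
  hidden layer. Its stride is at least `p`, so that its `d j.succ` channels have dimension one and
  form a vector. The hidden layer itself is passed on unchanged. -/
  | output (j : Fin J) {p n : ℕ} (Φ : CNN s d j.castSucc p n)
      (w : Fin (d j.succ) → Fin n → Fin s → ℝ) (b : Fin (d j.succ) → ℝ) : CNN s d j.succ p n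

namespace CNN

variable {s J : ℕ} {d : Fin (J + 1) → ℕ}

/-- The last hidden layer: channel, then position. -/
noncomputable def hidden : {j : Fin (J + 1)} → {p n : ℕ} → CNN s d j p n →
    (Fin (d 0) → ℝ) → Fin n → Fin p → ℝ
  | _, _, _, input, y => fun _ i => y i
  | _, _, _, conv Φ t _ _ _ _ _ w b, y => fun c i =>
      max ((∑ c', convEntry t (w c c') (Φ.hidden y c') i) + b c) 0
  | _, _, _, flatten Φ hp, y => fun _ i => Φ.hidden y i ⟨0, by omega⟩
  | _, _, _, output _ Φ _ _, y => Φ.hidden y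

/-- The intermediate outputs. Only the entries that have been attached are meaningful; the others
are zero. -/
noncomputable def outputs : {j : Fin (J + 1)} → {p n : ℕ} → CNN s d j p n →
    (Fin (d 0) → ℝ) → (i : Fin (J + 1)) → Fin (d i) → ℝ
  | _, _, _, input, _ => fun _ _ => 0
  | _, _, _, conv Φ _ _ _ _ _ _ _ _, y => Φ.outputs y
  | _, _, _, flatten Φ _, y => Φ.outputs y
  | _, _, _, output (p := p) j Φ w b, y =>
      Function.update (Φ.outputs y) j.succ
        (fun c => (∑ c', convEntry p (w c c') (Φ.hidden y c') 0) + b c)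

/-- The number of convolutional layers, the output layers included. -/
def depth : {j : Fin (J + 1)} → {p n : ℕ} → CNN s d j p n → ℕ
  | _, _, _, input => 0
  | _, _, _, conv Φ _ _ _ _ _ _ _ _ => Φ.depth + 1
  | _, _, _, flatten Φ _ => Φ.depth
  | _, _, _, output _ Φ _ _ => Φ.depth + 1

/-- The number of all filter entries and biases, zero or not. -/
def numWeights : {j : Fin (J + 1)} → {p n : ℕ} → CNN s d j p n → ℕ
  | _, _, _, input => 0
  | _, _, _, conv (n := n) Φ _ _ _ _ n' _ _ _ => Φ.numWeights + (n' * n * s + n')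
  | _, _, _, flatten Φ _ => Φ.numWeights
  | _, _, _, output (n := n) j Φ _ _ => Φ.numWeights + (d j.succ * n * s + d j.succ)

/-- The number of non-zero filter entries and biases. -/
noncomputable def numNonzeroWeights : {j : Fin (J + 1)} → {p n : ℕ} → CNN s d j p n → ℕ
  | _, _, _, input => 0
  | _, _, _, conv Φ _ _ _ _ _ _ w b =>
      Φ.numNonzeroWeights + ((∑ c, ∑ c', hammingNorm (w c c')) + hammingNorm b)
  | _, _, _, flatten Φ _ => Φ.numNonzeroWeights
  | _, _, _, output _ Φ w b =>
      Φ.numNonzeroWeights + ((∑ c, ∑ c', hammingNorm (w c c')) + hammingNorm b)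

end CNN

/-- `Φ` approximates the sparse codes of all layers within `err`, for every observation `y` that has
a noiseless deep sparse coding solution with entries bounded by `B`. -/
def ApproximatesCodes {s J : ℕ} {d : Fin (J + 1) → ℕ} {p n : ℕ}
    (D : ∀ j : Fin J, Matrix (Fin (d j.castSucc)) (Fin (d j.succ)) ℝ) (lam : Fin J → ℝ) (B : ℝ)
    (Φ : CNN s d (Fin.last J) p n) (err : ℝ) : Prop :=
  ∀ (y : Fin (d 0) → ℝ) (x : ∀ j : Fin (J + 1), Fin (d j) → ℝ),
    IsDSCSolution D lam 0 y x → (∀ (j : Fin J) (i : Fin (d j.succ)), |x j.succ i| ≤ B) →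
      ∀ j : Fin J, l2norm (Φ.outputs y j.succ - x j.succ) ≤ err

/-! ### Soft thresholding and the iterative shrinkage-thresholding algorithm -/

/-! The network unrolls iterative soft thresholding. For normalised columns, a gradient step from
`v` errs at coordinate `i` by at most μ times the ℓ¹ error on the other coordinates, plus the noise.
A threshold just above this kills every coordinate off the support of the code, so the error lives
on at most λ coordinates, and its ℓ¹ norm is multiplied by at most max(0, μ(2λ-1)) < 1 up to a noise
term 2λδ (`ista_error`).

Stage j runs K iterations on the approximation of the code of the preceding layer. The inherited
error acts as noise; it is already O(r^K), so the new error is again O(r^K), with the constants of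
`codeErrorBound`.

Soft thresholding is a difference of two ReLUs. Once all channels have dimension one, an iteration
is therefore one layer, signed values being carried as differences of hidden entries (`Reads`).
Strided layers that only sort the input into channels lead there in about log_s d_0 layers
(`exists_gather`). All filters have at most one non-zero entry, which gives the factor s between the
two weight counts. -/

/-- Soft thresholding at level `θ`. -/
noncomputable def softThreshold (θ u : ℝ) : ℝ := max (u - θ) 0 - max (-u - θ) 0

theorem softThreshold_zero_left (u : ℝ) : softThreshold 0 u = u := by
  unfold softThreshold
  rcases le_total u 0 with h | h
  · rw [max_eq_right (by linarith), max_eq_left (by linarith)]; ring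
  · rw [max_eq_left (by linarith), max_eq_right (by linarith)]; ring

theorem softThreshold_eq_zero {θ u : ℝ} (h : |u| ≤ θ) : softThreshold θ u = 0 := by
  obtain ⟨h1, h2⟩ := abs_le.mp h
  unfold softThreshold
  rw [max_eq_right (by linarith), max_eq_right (by linarith), sub_zero]

theorem abs_softThreshold_sub_le {θ u : ℝ} (hθ : 0 ≤ θ) : |softThreshold θ u - u| ≤ θ := by
  rw [abs_le]
  unfold softThreshold
  rcases max_cases (u - θ) 0 with h | h <;> rcases max_cases (-u - θ) 0 with h' | h' <;>
    constructor <;> linarith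

/-- The `k`-th iterate of the iterative shrinkage-thresholding algorithm with unit step size,
thresholds `θ` and observation `z`, started at zero. -/
noncomputable def ista {m n : ℕ} (A : Matrix (Fin m) (Fin n) ℝ) (θ : ℕ → ℝ) (z : Fin m → ℝ) :
    ℕ → Fin n → ℝ
  | 0 => 0
  | k + 1 => fun i =>
      softThreshold (θ k) (ista A θ z k i + ∑ l, A l i * (z l - ∑ i', A l i' * ista A θ z k i'))

theorem l2norm_sq {m : ℕ} (v : Fin m → ℝ) : l2norm v ^ 2 = ∑ i, v i ^ 2 := by
  unfold l2norm
  rw [EuclideanSpace.real_norm_sq_eq]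

theorem l2norm_le_sum_abs {m : ℕ} (v : Fin m → ℝ) : l2norm v ≤ ∑ i, |v i| := by
  have h0 : 0 ≤ ∑ i, |v i| := Finset.sum_nonneg fun i _ => abs_nonneg _
  refine abs_le_of_sq_le_sq' ?_ h0 |>.2
  rw [l2norm_sq]
  calc ∑ i, v i ^ 2 = ∑ i, |v i| ^ 2 := by simp
    _ ≤ (∑ i, |v i|) ^ 2 := Finset.sum_sq_le_sq_sum_of_nonneg fun i _ => abs_nonneg _

theorem l2norm_eq_zero {m : ℕ} {v : Fin m → ℝ} (h : l2norm v ≤ 0) : v = 0 := by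
  have h' : l2norm v = 0 := le_antisymm h (norm_nonneg _)
  unfold l2norm at h'
  simpa using h'

/-! ### Mutual coherence and contraction in ℓ¹. -/

section Coherence

variable {m n : ℕ} {A : Matrix (Fin m) (Fin n) ℝ}

theorem mutualCoherence_nonneg (A : Matrix (Fin m) (Fin n) ℝ) : 0 ≤ mutualCoherence A :=
  Real.iSup_nonneg fun _ =>
    div_nonneg (abs_nonneg _) (mul_nonneg (norm_nonneg _) (norm_nonneg _))

theorem ColumnNormalized.sum_mul_self (hA : ColumnNormalized A) (i : Fin n) :
    ∑ l, A l i * A l i = 1 := by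
  have h := l2norm_sq fun l => A l i
  rw [hA i] at h
  simpa [sq] using h.symm

theorem ColumnNormalized.abs_entry_le_one (hA : ColumnNormalized A) (l : Fin m) (i : Fin n) :
    |A l i| ≤ 1 := by
  rw [← sq_le_one_iff_abs_le_one, sq, ← hA.sum_mul_self i]
  exact Finset.single_le_sum (f := fun l => A l i * A l i)
    (fun l _ => mul_self_nonneg _) (Finset.mem_univ l)

theorem ColumnNormalized.abs_sum_mul_le (hA : ColumnNormalized A) {i i' : Fin n} (h : i ≠ i') :
    |∑ l, A l i * A l i'| ≤ mutualCoherence A := by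
  have := le_ciSup (f := fun p : {p : Fin n × Fin n // p.1 ≠ p.2} =>
    |∑ i, A i p.1.1 * A i p.1.2| /
      (l2norm (fun i => A i p.1.1) * l2norm (fun i => A i p.1.2)))
    (Set.finite_range _).bddAbove ⟨(i, i'), h⟩
  simp only [hA i, hA i', mul_one, div_one] at this
  exact this

/-- The factor by which an iteration of the thresholding algorithm decreases the `ℓ¹` error. -/
noncomputable def contractionFactor (A : Matrix (Fin m) (Fin n) ℝ) (lam : ℝ) : ℝ :=
  max 0 (mutualCoherence A * (2 * lam - 1))

theorem contractionFactor_nonneg (A : Matrix (Fin m) (Fin n) ℝ) (lam : ℝ) :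
    0 ≤ contractionFactor A lam := le_max_left _ _

/-- Multiplied out, the sparsity condition reads μ(2λ-1) < 1. For μ = 0 it is void, but then the
product vanishes. -/
theorem SparsityCondition.contractionFactor_lt_one {lam : ℝ} (h : SparsityCondition A lam) :
    contractionFactor A lam < 1 := by
  refine max_lt one_pos ?_
  rcases (mutualCoherence_nonneg A).eq_or_lt with h0 | h0
  · rw [← h0, zero_mul]; exact one_pos
  · have h1 := h h0
    have h2 : 2 * lam - 1 < 1 / mutualCoherence A := by linarith
    rwa [lt_div_iff₀ h0, mul_comm] at h2

/-- The `ℓ¹` error of the iterates for an observation with noise level `δ`, by recursion. -/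
noncomputable def istaErrorBound (q lam δ e₀ : ℝ) : ℕ → ℝ
  | 0 => e₀
  | k + 1 => q * istaErrorBound q lam δ e₀ k + 2 * lam * δ

theorem istaErrorBound_nonneg {q lam δ e₀ : ℝ} (hq : 0 ≤ q) (hl : 0 ≤ lam) (hδ : 0 ≤ δ)
    (he : 0 ≤ e₀) : ∀ k, 0 ≤ istaErrorBound q lam δ e₀ k
  | 0 => he
  | k + 1 => by
    have := istaErrorBound_nonneg hq hl hδ he k
    unfold istaErrorBound
    positivity

/-- The last term is the fixed point of `e ↦ r * e + 2 * lam * δ`. The larger rate `r` allows one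
rate for all dictionaries. -/
theorem istaErrorBound_le {q lam δ e₀ r : ℝ} (hq : 0 ≤ q) (hqr : q ≤ r) (hr : r < 1)
    (hl : 0 ≤ lam) (hδ : 0 ≤ δ) (he : 0 ≤ e₀) (k : ℕ) :
    istaErrorBound q lam δ e₀ k ≤ r ^ k * e₀ + 2 * lam * δ / (1 - r) := by
  have hr' : 0 < 1 - r := by linarith
  have hr0 : 0 ≤ r := hq.trans hqr
  induction k with
  | zero =>
    have : 0 ≤ 2 * lam * δ / (1 - r) := by positivity
    simpa [istaErrorBound] using this
  | succ k ih =>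
    have h0 := istaErrorBound_nonneg hq hl hδ he k
    have h1 : 2 * lam * δ / (1 - r) = r * (2 * lam * δ / (1 - r)) + 2 * lam * δ := by
      field_simp; ring
    calc istaErrorBound q lam δ e₀ (k + 1)
        = q * istaErrorBound q lam δ e₀ k + 2 * lam * δ := rfl
      _ ≤ r * (r ^ k * e₀ + 2 * lam * δ / (1 - r)) + 2 * lam * δ := by gcongr
      _ = r ^ (k + 1) * e₀ + (r * (2 * lam * δ / (1 - r)) + 2 * lam * δ) := by ring
      _ = _ := by rw [← h1]

/-- The thresholds for which the iterates keep the support of the code. -/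
noncomputable def istaThreshold (A : Matrix (Fin m) (Fin n) ℝ) (lam δ e₀ : ℝ) (k : ℕ) : ℝ :=
  mutualCoherence A * istaErrorBound (contractionFactor A lam) lam δ e₀ k + δ

/-- A gradient step from `v` deviates from the code `x` only by the noise and by the coherence of
distinct columns. -/
theorem ColumnNormalized.abs_gradientStep_sub_le (hA : ColumnNormalized A) {z : Fin m → ℝ}
    {x v : Fin n → ℝ} {δ : ℝ} (hz : ∑ l, |z l - ∑ i, A l i * x i| ≤ δ) (i : Fin n) :
    |v i + ∑ l, A l i * (z l - ∑ i', A l i' * v i') - x i| ≤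
      mutualCoherence A * (∑ i', |v i' - x i'| - |v i - x i|) + δ := by
  have hnoise : |∑ l, A l i * (z l - ∑ i', A l i' * x i')| ≤ δ := by
    refine (Finset.abs_sum_le_sum_abs _ _).trans (le_trans (Finset.sum_le_sum fun l _ => ?_) hz)
    rw [abs_mul]
    exact mul_le_of_le_one_left (abs_nonneg _) (hA.abs_entry_le_one l i)
  have hsplit : ∑ l, A l i * (z l - ∑ i', A l i' * v i') =
      ∑ l, A l i * (z l - ∑ i', A l i' * x i') +
        ∑ i', (∑ l, A l i * A l i') * (x i' - v i') := by
    simp_rw [Finset.sum_mul]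
    rw [Finset.sum_comm (s := Finset.univ (α := Fin n)), ← Finset.sum_add_distrib]
    refine Finset.sum_congr rfl fun l _ => ?_
    have : ∑ i', A l i * A l i' * (x i' - v i') =
        A l i * (∑ i', A l i' * x i' - ∑ i', A l i' * v i') := by
      rw [← Finset.sum_sub_distrib, Finset.mul_sum]
      exact Finset.sum_congr rfl fun i' _ => by ring
    rw [this]; ring
  have hdiag := Finset.add_sum_erase Finset.univ
    (fun i' => (∑ l, A l i * A l i') * (x i' - v i')) (Finset.mem_univ i)
  have hdiag' := Finset.add_sum_erase Finset.univ (fun i' => |v i' - x i'|) (Finset.mem_univ i)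
  have hoff : |∑ i' ∈ Finset.univ.erase i, (∑ l, A l i * A l i') * (x i' - v i')| ≤
      mutualCoherence A * ∑ i' ∈ Finset.univ.erase i, |v i' - x i'| := by
    rw [Finset.mul_sum]
    refine (Finset.abs_sum_le_sum_abs _ _).trans (Finset.sum_le_sum fun i' hi' => ?_)
    rw [abs_mul, abs_sub_comm (v i')]
    exact mul_le_mul_of_nonneg_right
      (hA.abs_sum_mul_le (Finset.ne_of_mem_erase hi').symm) (abs_nonneg _)
  simp only [hA.sum_mul_self, one_mul] at hdiag
  -- The diagonal entry of the Gram matrix is one, so `v i` cancels and only off-diagonal entries,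
  -- bounded by the coherence, remain.
  have heq : v i + ∑ l, A l i * (z l - ∑ i', A l i' * v i') - x i =
      ∑ l, A l i * (z l - ∑ i', A l i' * x i') +
        ∑ i' ∈ Finset.univ.erase i, (∑ l, A l i * A l i') * (x i' - v i') := by
    rw [hsplit, ← hdiag]; ring
  have heq' : ∑ i', |v i' - x i'| - |v i - x i| =
      ∑ i' ∈ Finset.univ.erase i, |v i' - x i'| := by
    rw [← hdiag']; ring
  rw [heq, heq']
  have := abs_add_le (∑ l, A l i * (z l - ∑ i', A l i' * x i'))
    (∑ i' ∈ Finset.univ.erase i, (∑ l, A l i * A l i') * (x i' - v i'))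
  linarith

/-- The two claims need each other: the threshold dominates the gradient error because of the ℓ¹
bound, and the ℓ¹ bound contracts because only coordinates in the support contribute. Each of these
pays the gradient error and the threshold, whence the 2 in 2λ-1 and 2λδ; the -1 comes from the
absent diagonal. -/
theorem ista_error (hA : ColumnNormalized A) {lam δ e₀ : ℝ} (hδ : 0 ≤ δ)
    {z : Fin m → ℝ} {x : Fin n → ℝ} (hsp : (hammingNorm x : ℝ) ≤ lam)
    (hz : ∑ l, |z l - ∑ i, A l i * x i| ≤ δ) (hx : ∑ i, |x i| ≤ e₀) (k : ℕ) :
    (∀ i, x i = 0 → ista A (istaThreshold A lam δ e₀) z k i = 0) ∧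
    ∑ i, |ista A (istaThreshold A lam δ e₀) z k i - x i| ≤
      istaErrorBound (contractionFactor A lam) lam δ e₀ k := by
  induction k with
  | zero => simpa [ista, istaErrorBound] using hx
  | succ k ih =>
    obtain ⟨hsupp, herr⟩ := ih
    set v := ista A (istaThreshold A lam δ e₀) z k
    set e := istaErrorBound (contractionFactor A lam) lam δ e₀ k with he
    set θ := istaThreshold A lam δ e₀ k with hθ
    set μ := mutualCoherence A with hμ
    have hμ0 : 0 ≤ μ := mutualCoherence_nonneg A
    have hv0 : 0 ≤ ∑ i, |v i - x i| := Finset.sum_nonneg fun i _ => abs_nonneg _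
    have hθe : θ = μ * e + δ := rfl
    have he0 : 0 ≤ e := hv0.trans herr
    have hθ0 : 0 ≤ θ := by rw [hθe]; positivity
    have hstep := hA.abs_gradientStep_sub_le (v := v) hz
    have hzero : ∀ i, x i = 0 → ista A (istaThreshold A lam δ e₀) z (k + 1) i = 0 := by
      intro i hi
      refine softThreshold_eq_zero ?_
      have h1 := hstep i
      rw [hi, sub_zero] at h1
      refine h1.trans ?_
      change _ ≤ θ
      rw [hθe]
      have : ∑ i', |v i' - x i'| - |v i - 0| ≤ e := by
        have := abs_nonneg (v i - 0)
        linarith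
      gcongr
    refine ⟨hzero, ?_⟩
    set S := Finset.univ.filter fun i => x i ≠ 0 with hS
    have hcard : (S.card : ℝ) ≤ lam := hsp
    have hrestrict : ∀ w : Fin n → ℝ, (∀ i, x i = 0 → w i = 0) →
        ∑ i, |w i - x i| = ∑ i ∈ S, |w i - x i| := by
      intro w hw
      refine (Finset.sum_subset (Finset.subset_univ S) fun i _ hi => ?_).symm
      have hxi : x i = 0 := by simpa [hS] using hi
      rw [hw i hxi, hxi]; simp
    have hvS := hrestrict v hsupp
    rw [hrestrict _ hzero]
    have hbound : ∀ i ∈ S, |ista A (istaThreshold A lam δ e₀) z (k + 1) i - x i| ≤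
        (μ * (∑ i', |v i' - x i'|) + δ + θ) - μ * |v i - x i| := by
      intro i _
      have h1 := hstep i
      have h2 := abs_softThreshold_sub_le
        (u := v i + ∑ l, A l i * (z l - ∑ i', A l i' * v i')) hθ0
      have h3 := abs_sub_le (ista A (istaThreshold A lam δ e₀) z (k + 1) i)
        (v i + ∑ l, A l i * (z l - ∑ i', A l i' * v i')) (x i)
      change |ista A (istaThreshold A lam δ e₀) z (k + 1) i - _| ≤ _ at h2
      rw [mul_sub] at h1
      linarith
    refine (Finset.sum_le_sum hbound).trans ?_
    rw [Finset.sum_sub_distrib, Finset.sum_const, nsmul_eq_mul, ← Finset.mul_sum, ← hvS]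
    set N := ∑ i, |v i - x i|
    change _ ≤ contractionFactor A lam * e + 2 * lam * δ
    -- For empty support `S.card - 1` is negative and the estimate below would fail.
    rcases S.eq_empty_or_nonempty with hemp | hne
    · have hl : 0 ≤ lam := le_trans (Nat.cast_nonneg _) hcard
      have h1 : 0 ≤ contractionFactor A lam := contractionFactor_nonneg A lam
      have h2 : 0 ≤ contractionFactor A lam * e + 2 * lam * δ := by positivity
      rw [hemp]
      simp only [Finset.card_empty, Nat.cast_zero, zero_mul]
      have : 0 ≤ μ * N := by positivity
      linarith
    · have h1 : (1 : ℝ) ≤ S.card := by exact_mod_cast hne.card_pos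
      have hcf : μ * (2 * lam - 1) ≤ contractionFactor A lam := le_max_right _ _
      calc (S.card : ℝ) * (μ * N + δ + θ) - μ * N
          = μ * ((S.card - 1) * N) + S.card * (μ * e) + 2 * S.card * δ := by rw [hθe]; ring
        _ ≤ μ * ((S.card - 1) * e) + S.card * (μ * e) + 2 * S.card * δ := by
          have : (0 : ℝ) ≤ S.card - 1 := by linarith
          gcongr
        _ = μ * (2 * S.card - 1) * e + 2 * S.card * δ := by ring
        _ ≤ μ * (2 * lam - 1) * e + 2 * lam * δ := by gcongr
        _ ≤ _ := by gcongr

end Coherence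
/-! ### Layers of convolutional networks -/

namespace CNN

variable {s J : ℕ} {d : Fin (J + 1) → ℕ}

/-- `Φ'` arises from `Φ` by hidden layers only: at most `N` of them, with at most `X` non-zero
weights and at most `s * X` weights. -/
structure Extends {j : Fin (J + 1)} {p n p' n' : ℕ} (Φ : CNN s d j p n) (Φ' : CNN s d j p' n')
    (N X : ℕ) : Prop where
  outputs_eq : ∀ y, Φ'.outputs y = Φ.outputs y
  depth_le : Φ'.depth ≤ Φ.depth + N
  nonzero_le : Φ'.numNonzeroWeights ≤ Φ.numNonzeroWeights + X
  weights_le : Φ'.numWeights ≤ Φ.numWeights + s * X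

theorem Extends.refl {j : Fin (J + 1)} {p n : ℕ} (Φ : CNN s d j p n) : Φ.Extends Φ 0 0 :=
  ⟨fun _ => rfl, le_rfl, le_rfl, le_rfl⟩

theorem Extends.trans {j : Fin (J + 1)} {p n p' n' p'' n'' N X N' X' : ℕ} {Φ : CNN s d j p n}
    {Φ' : CNN s d j p' n'} {Φ'' : CNN s d j p'' n''} (h : Φ.Extends Φ' N X)
    (h' : Φ'.Extends Φ'' N' X') : Φ.Extends Φ'' (N + N') (X + X') where
  outputs_eq y := (h'.outputs_eq y).trans (h.outputs_eq y)
  depth_le := by have := h.depth_le; have := h'.depth_le; omega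
  nonzero_le := by have := h.nonzero_le; have := h'.nonzero_le; omega
  weights_le := by have := h.weights_le; have := h'.weights_le; rw [mul_add]; omega

theorem Extends.mono {j : Fin (J + 1)} {p n p' n' N X N' X' : ℕ} {Φ : CNN s d j p n}
    {Φ' : CNN s d j p' n'} (h : Φ.Extends Φ' N X) (hN : N ≤ N') (hX : X ≤ X') :
    Φ.Extends Φ' N' X' where
  outputs_eq := h.outputs_eq
  depth_le := h.depth_le.trans (by omega)
  nonzero_le := h.nonzero_le.trans (by omega)
  weights_le := h.weights_le.trans (by gcongr)

/-- Every coordinate of `f` is the difference of two entries of the last hidden layer. -/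
def Reads {j : Fin (J + 1)} {p n : ℕ} {κ : Type} (Φ : CNN s d j p n)
    (f : (Fin (d 0) → ℝ) → κ → ℝ) : Prop :=
  ∃ P Q : κ → Fin n × Fin p, ∀ y k,
    f y k = Φ.hidden y (P k).1 (P k).2 - Φ.hidden y (Q k).1 (Q k).2

/-- A signal continued by zero. -/
def zeroExtend {p : ℕ} (h : Fin p → ℝ) (m : ℕ) : ℝ := if hm : m < p then h ⟨m, hm⟩ else 0

theorem zeroExtend_of_lt {p : ℕ} (h : Fin p → ℝ) {m : ℕ} (hm : m < p) :
    zeroExtend h m = h ⟨m, hm⟩ := dif_pos hm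

theorem convEntry_single {p : ℕ} (t : ℕ) (k : Fin s) (a : ℝ) (h : Fin p → ℝ) (i : ℕ) :
    convEntry t (Pi.single k a) h i = a * zeroExtend h (i * t + k) := by
  unfold convEntry
  rw [Finset.sum_eq_single k]
  · rw [Pi.single_eq_same]; rfl
  · intro b _ hb
    rw [Pi.single_eq_of_ne hb, zero_mul]
  · simp

theorem hammingNorm_single_le (k : Fin s) (a : ℝ) :
    hammingNorm (Pi.single k a : Fin s → ℝ) ≤ 1 := by
  unfold hammingNorm
  refine Finset.card_le_one.mpr fun i hi i' hi' => ?_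
  have aux : ∀ i, (Pi.single k a : Fin s → ℝ) i ≠ 0 → i = k := fun i h => by
    by_contra hik
    exact h (Pi.single_eq_of_ne (M := fun _ => ℝ) hik a)
  rw [aux i (by simpa using hi), aux i' (by simpa using hi')]

theorem sum_hammingNorm_single_le {n n' : ℕ} (k : Fin n' → Fin s) (W : Fin n' → Fin n → ℝ) :
    ∑ c, ∑ c', hammingNorm (Pi.single (k c) (W c c') : Fin s → ℝ) ≤ n' * n := by
  calc ∑ c, ∑ c', hammingNorm (Pi.single (k c) (W c c') : Fin s → ℝ)
      ≤ ∑ _c : Fin n', ∑ _c' : Fin n, 1 :=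
        Finset.sum_le_sum fun c _ => Finset.sum_le_sum fun c' _ => hammingNorm_single_le _ _
    _ = n' * n := by simp

/-- A convolutional layer all of whose filters have a single non-zero entry, with channels indexed
by `ι`. -/
theorem exists_conv_single {j : Fin (J + 1)} {p n : ℕ} (hs : 0 < s) (Φ : CNN s d j p n)
    (t : ℕ) (ht : 1 ≤ t)
    {ι : Type} [Fintype ι] [Nonempty ι] (k : ι → Fin s) (W : ι → Fin n → ℝ) (b : ι → ℝ) :
    ∃ (Φ' : CNN s d j (p ⌈/⌉ t) (Fintype.card ι)) (e : ι ≃ Fin (Fintype.card ι)),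
      (∀ y i x, Φ'.hidden y (e i) x =
        max ((∑ c, W i c * zeroExtend (Φ.hidden y c) (x * t + k i)) + b i) 0) ∧
      Φ.Extends Φ' 1 (Fintype.card ι * (n + 1)) := by
  let e := Fintype.equivFin ι
  refine ⟨conv Φ t ht _ rfl _ Fintype.card_pos
    (fun c c' => Pi.single (k (e.symm c)) (W (e.symm c) c')) (fun c => b (e.symm c)), e,
    fun y i x => ?_, fun y => rfl, le_rfl, ?_, ?_⟩
  · simp only [hidden, convEntry_single, Equiv.symm_apply_apply]
  · have h1 := sum_hammingNorm_single_le (fun c => k (e.symm c)) (fun c c' => W (e.symm c) c')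
    have h2 := hammingNorm_le_card_fintype (x := fun c => b (e.symm c))
    rw [Fintype.card_fin] at h2
    rw [mul_add, mul_one]
    exact Nat.add_le_add_left (Nat.add_le_add h1 h2) _
  · change Φ.numWeights + _ ≤ _
    have : Fintype.card ι ≤ s * Fintype.card ι := Nat.le_mul_of_pos_left _ hs
    have h : s * (Fintype.card ι * (n + 1)) =
      Fintype.card ι * n * s + s * Fintype.card ι := by ring
    omega

/-- A layer on channels of dimension one can apply any matrix followed by soft thresholding. -/
theorem Reads.exists_softThreshold {j : Fin (J + 1)} {n : ℕ} (hs : 0 < s) {Φ : CNN s d j 1 n}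
    {κ ι : Type} [Fintype κ] [Fintype ι] [Nonempty ι] {f : (Fin (d 0) → ℝ) → κ → ℝ}
    (hf : Φ.Reads f) (W : ι → κ → ℝ) (θ : ι → ℝ) :
    ∃ Φ' : CNN s d j 1 (2 * Fintype.card ι),
      Φ'.Reads (fun y i => softThreshold (θ i) (∑ k, W i k * f y k)) ∧
      Φ.Extends Φ' 1 (2 * Fintype.card ι * (n + 1)) := by
  classical
  obtain ⟨P, Q, hPQ⟩ := hf
  let V : ι → Fin n → ℝ := fun i c =>
    ∑ k, W i k * ((if c = (P k).1 then 1 else 0) - (if c = (Q k).1 then 1 else 0))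
  have hV : ∀ y i, ∑ c, V i c * Φ.hidden y c 0 = ∑ k, W i k * f y k := by
    intro y i
    simp only [V, Finset.sum_mul]
    rw [Finset.sum_comm]
    refine Finset.sum_congr rfl fun k _ => ?_
    rw [hPQ, Subsingleton.elim (P k).2 0, Subsingleton.elim (Q k).2 0]
    simp only [mul_assoc, ← Finset.mul_sum, sub_mul, Finset.sum_sub_distrib, ite_mul, one_mul,
      zero_mul, Finset.sum_ite_eq', Finset.mem_univ, if_true]
  -- The two copies of `ι` carry the ReLUs of u - θ and -u - θ, whose difference is the soft
  -- thresholding of u.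
  obtain ⟨Φ', e, hΦ', hext⟩ := exists_conv_single hs Φ 1 le_rfl (ι := ι ⊕ ι)
    (fun _ => ⟨0, hs⟩) (Sum.elim V fun i c => -V i c) (Sum.elim (fun i => -θ i) fun i => -θ i)
  have hcard : Fintype.card (ι ⊕ ι) = 2 * Fintype.card ι := by
    rw [Fintype.card_sum, two_mul]
  have hp : 1 ⌈/⌉ 1 = 1 := by simp
  revert Φ' e
  rw [hcard, hp]
  intro Φ' e hΦ' hext
  refine ⟨Φ', ⟨fun i => (e (Sum.inl i), 0), fun i => (e (Sum.inr i), 0), fun y i => ?_⟩, hext⟩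
  simp only [hΦ', Sum.elim_inl, Sum.elim_inr, Fin.val_zero, zero_mul, zero_add,
    zeroExtend_of_lt _ one_pos, neg_mul, Finset.sum_neg_distrib]
  have h := hV y i
  simp only [show (⟨0, one_pos⟩ : Fin 1) = 0 from rfl, h]
  rfl

/-! ### Reducing the input to channels of dimension one. -/

/-- Strided layers with `s` times as many channels reduce the dimension of channels to one. -/
theorem exists_gather_pow {j : Fin (J + 1)} {κ : Type} {f : (Fin (d 0) → ℝ) → κ → ℝ}
    (hs : 2 ≤ s) (L : ℕ) : ∀ {p n : ℕ} (_ : 0 < p) (_ : p ≤ s ^ L) (_ : 0 < n)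
    (Φ : CNN s d j p n) (_ : ∀ y c i, 0 ≤ Φ.hidden y c i) (_ : Φ.Reads f),
    ∃ (n' X : ℕ) (Φ' : CNN s d j 1 n'), n' = n * s ^ L ∧ Φ'.Reads f ∧
      X + 2 * n ^ 2 ≤ 2 * n' ^ 2 ∧ Φ.Extends Φ' L X := by
  induction L with
  | zero =>
    intro p n hp hpL hn Φ _ hΦ
    obtain rfl : p = 1 := by rw [pow_zero] at hpL; omega
    exact ⟨n, 0, Φ, by simp, hΦ, by simp, Extends.refl Φ⟩
  | succ L ih =>
    intro p n hp hpL hn Φ hpos hΦ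
    have hs0 : 0 < s := by omega
    have : Nonempty (Fin n × Fin s) := ⟨⟨0, hn⟩, ⟨0, hs0⟩⟩
    obtain ⟨Φ₁, e, hΦ₁, hext⟩ := exists_conv_single hs0 Φ s hs0 (ι := Fin n × Fin s)
      (fun a => a.2) (fun a => Pi.single a.1 1) (fun _ => 0)
    have hcard : Fintype.card (Fin n × Fin s) = n * s := by simp
    revert Φ₁ e
    rw [hcard]
    intro Φ₁ e hΦ₁ hext
    have hq : p ⌈/⌉ s ≤ s ^ L := by
      rw [ceilDiv_le_iff_le_smul hs0, smul_eq_mul, mul_comm, ← pow_succ]; exact hpL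
    have hlt : ∀ i : Fin p, (i : ℕ) / s < p ⌈/⌉ s := fun i => by
      rw [Nat.ceilDiv_eq_add_pred_div, Nat.lt_iff_add_one_le, Nat.le_div_iff_mul_le hs0]
      have := Nat.div_mul_le_self (i : ℕ) s
      have := i.2
      rw [add_mul]; omega
    have hq0 : 0 < p ⌈/⌉ s := lt_of_le_of_lt (Nat.zero_le _) (hlt ⟨0, hp⟩)
    -- Entry `i` moves to position `i / s` of the copy of its channel with offset `i % s`; ReLU
    -- leaves it unchanged since it is nonnegative.
    have hloc : ∀ y c (i : Fin p), Φ.hidden y c i =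
        Φ₁.hidden y (e (c, ⟨i % s, Nat.mod_lt _ hs0⟩)) ⟨i / s, hlt i⟩ := by
      intro y c i
      rw [hΦ₁, Finset.sum_eq_single c (fun b _ hb => by simp [hb])
        (by simp)]
      simp only [Pi.single_eq_same, one_mul, add_zero, Nat.div_add_mod', zeroExtend_of_lt _ i.2,
        Fin.eta]
      exact (max_eq_left (hpos y c i)).symm
    obtain ⟨P, Q, hPQ⟩ := hΦ
    obtain ⟨n', X, Φ', hn', hread, hX, hext'⟩ := ih hq0 hq (Nat.mul_pos hn hs0) Φ₁
      (fun y c i => by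
        obtain ⟨a, rfl⟩ := e.surjective c
        rw [hΦ₁]; exact le_max_right _ _)
      ⟨fun k => (e ((P k).1, ⟨(P k).2 % s, Nat.mod_lt _ hs0⟩), ⟨(P k).2 / s, hlt _⟩),
        fun k => (e ((Q k).1, ⟨(Q k).2 % s, Nat.mod_lt _ hs0⟩), ⟨(Q k).2 / s, hlt _⟩),
        fun y k => by rw [hPQ, hloc, hloc y (Q k).1]⟩
    refine ⟨n', n * s * (n + 1) + X, Φ', by rw [hn', pow_succ]; ring, hread, ?_,
      (hext.trans hext').mono (by omega) le_rfl⟩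
    -- The term `2 * n ^ 2` makes the weight bound telescope: a layer's cost is absorbed by the
    -- growth of the width from `n` to `n * s`.
    have : n * s * (n + 1) + 2 * n ^ 2 ≤ 2 * (n * s) ^ 2 := by
      have h1 : n * s * (n + 1) ≤ 2 * s * n ^ 2 := by
        have : n ≤ n ^ 2 := Nat.le_self_pow two_ne_zero n
        calc n * s * (n + 1) = s * (n ^ 2 + n) := by ring
          _ ≤ s * (n ^ 2 + n ^ 2) := by gcongr
          _ = _ := by ring
      have h2 : s + 1 ≤ s ^ 2 := by nlinarith
      calc n * s * (n + 1) + 2 * n ^ 2 ≤ 2 * s * n ^ 2 + 2 * n ^ 2 := by gcongr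
        _ = 2 * n ^ 2 * (s + 1) := by ring
        _ ≤ 2 * n ^ 2 * s ^ 2 := by gcongr
        _ = _ := by ring
    omega

/-- A network with channels of dimension one that passes the input on. -/
theorem exists_gather (hs : 2 ≤ s) (hd : 0 < d 0) :
    ∃ (L n : ℕ) (Φ : CNN s d 0 1 n), s ^ L ≤ d 0 ∧ n ≤ 4 * d 0 ∧ Φ.Reads (fun y i => y i) ∧
      Φ.depth ≤ L + 1 ∧ Φ.numNonzeroWeights ≤ 40 * d 0 ^ 2 ∧
      Φ.numWeights ≤ s * (40 * d 0 ^ 2) := by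
  obtain ⟨L, hL, hL'⟩ : ∃ L, s ^ L ≤ d 0 ∧ d 0 < s ^ (L + 1) :=
    ⟨Nat.log s (d 0), Nat.pow_log_le_self s hd.ne', Nat.lt_pow_succ_log_self (by omega) _⟩
  have hs0 : 0 < s := by omega
  have hsL : 0 < s ^ L := Nat.pow_pos hs0
  -- The first stride is as small as possible. With stride s in all L + 1 layers, the width could
  -- reach the order of s · d_0, and the weight bound would depend on s.
  obtain ⟨t, ht⟩ : ∃ t, t = d 0 ⌈/⌉ s ^ L := ⟨_, rfl⟩
  have hts : t ≤ s := by
    rw [ht, ceilDiv_le_iff_le_smul hsL, smul_eq_mul, ← pow_succ]; exact hL'.le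
  have hdt : d 0 ≤ s ^ L * t := by
    rw [← smul_eq_mul, ← ceilDiv_le_iff_le_smul hsL, ht]
  have ht0 : 0 < t := by
    rcases Nat.eq_zero_or_pos t with h | h
    · rw [h] at hdt; omega
    · exact h
  have htL : t * s ^ L ≤ 2 * d 0 := by
    have : t * s ^ L ≤ d 0 + s ^ L - 1 := by
      rw [ht, Nat.ceilDiv_eq_add_pred_div]; exact Nat.div_mul_le_self _ _
    omega
  have : Nonempty (Fin t × Bool) := ⟨⟨0, ht0⟩, true⟩
  -- The input has no sign, so its positive and negative parts get separate channels.
  obtain ⟨Φ₁, e, hΦ₁, hext⟩ := exists_conv_single hs0 (CNN.input : CNN s d 0 (d 0) 1) t ht0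
    (ι := Fin t × Bool) (fun a => Fin.castLE hts a.1) (fun a _ => if a.2 then 1 else -1)
    (fun _ => 0)
  have hcard : Fintype.card (Fin t × Bool) = t * 2 := by simp
  revert Φ₁ e
  rw [hcard]
  intro Φ₁ e hΦ₁ hext
  have hq : d 0 ⌈/⌉ t ≤ s ^ L := by
    rw [ceilDiv_le_iff_le_smul ht0, smul_eq_mul, mul_comm]; exact hdt
  have hlt : ∀ i : Fin (d 0), (i : ℕ) / t < d 0 ⌈/⌉ t := fun i => by
    rw [Nat.ceilDiv_eq_add_pred_div, Nat.lt_iff_add_one_le, Nat.le_div_iff_mul_le ht0]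
    have := Nat.div_mul_le_self (i : ℕ) t
    have := i.2
    rw [add_mul]; omega
  have hq0 : 0 < d 0 ⌈/⌉ t := lt_of_le_of_lt (Nat.zero_le _) (hlt ⟨0, hd⟩)
  obtain ⟨n, X, Φ, hn, hread, hX, hext'⟩ := exists_gather_pow hs L hq0 hq (by omega) Φ₁
    (f := fun y i => y i)
    (fun y c i => by
      obtain ⟨a, rfl⟩ := e.surjective c
      rw [hΦ₁]; exact le_max_right _ _)
    ⟨fun i => (e (⟨i % t, Nat.mod_lt _ ht0⟩, true), ⟨i / t, hlt i⟩),
      fun i => (e (⟨i % t, Nat.mod_lt _ ht0⟩, false), ⟨i / t, hlt i⟩), fun y i => by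
      have hi : zeroExtend (hidden (CNN.input : CNN s d 0 (d 0) 1) y 0) i = y i :=
        zeroExtend_of_lt _ i.2
      simp only [hΦ₁, Fin.val_castLE, Nat.div_add_mod', Finset.univ_unique, Fin.default_eq_zero,
        Finset.sum_singleton, hi, if_true, Bool.false_eq_true, if_false, one_mul, neg_mul,
        add_zero]
      simp⟩
  have hn' : n = 2 * (t * s ^ L) := by rw [hn]; ring
  have hn4 : n ≤ 4 * d 0 := by omega
  have htn : t * 2 ≤ n := by
    rw [hn]; exact Nat.le_mul_of_pos_right _ hsL
  have hd2 : d 0 ≤ d 0 ^ 2 := Nat.le_self_pow two_ne_zero _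
  -- 40 = 32 + 8: the later layers cost at most 2n² ≤ 32 d_0², the first at most 2n ≤ 8 d_0.
  have hXb : t * 2 * (1 + 1) + X ≤ 40 * d 0 ^ 2 := by
    have : n ^ 2 ≤ (4 * d 0) ^ 2 := Nat.pow_le_pow_left hn4 2
    have h16 : (4 * d 0) ^ 2 = 16 * d 0 ^ 2 := by ring
    omega
  have h := (hext.trans hext').mono (by omega : 1 + L ≤ L + 1) hXb
  refine ⟨L, n, Φ, hL, hn4, hread, ?_, ?_, ?_⟩
  · simpa [depth] using h.depth_le
  · simpa [numNonzeroWeights] using h.nonzero_le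
  · simpa [numWeights] using h.weights_le

/-! ### Thresholding iterations as layers. -/

/-- Iterations of the thresholding algorithm as layers that pass the observation on. -/
theorem Reads.exists_ista {j : Fin (J + 1)} {n m q : ℕ} (hs : 0 < s) (hq : 0 < q)
    {Φ : CNN s d j 1 n} {f : (Fin (d 0) → ℝ) → Fin m → ℝ} (hf : Φ.Reads f)
    (A : Matrix (Fin m) (Fin q) ℝ) (θ : ℕ → ℝ) (K : ℕ) :
    ∃ Φ' : CNN s d j 1 (2 * (m + q)),
      Φ'.Reads (fun y => Sum.elim (f y) (ista A θ (f y) K)) ∧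
      Φ.Extends Φ' (K + 1)
        (2 * (m + q) * (n + 1) + K * (2 * (m + q) * (2 * (m + q) + 1))) := by
  classical
  have : Nonempty (Fin q) := ⟨⟨0, hq⟩⟩
  have hcard : Fintype.card (Fin m ⊕ Fin q) = m + q := by simp
  induction K with
  | zero =>
    obtain ⟨Φ', hΦ', hext⟩ := hf.exists_softThreshold hs (ι := Fin m ⊕ Fin q)
      (Sum.elim (fun i => Pi.single i 1) fun _ _ => 0) (fun _ => 0)
    revert Φ'
    rw [hcard]
    intro Φ' hΦ' hext
    refine ⟨Φ', ?_, hext.mono (by omega) (by omega)⟩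
    convert hΦ' using 3 with y i
    rw [softThreshold_zero_left]
    rcases i with i | i
    · simp [Pi.single_apply]
    · simp [ista]
  | succ K ih =>
    obtain ⟨Φ₁, hΦ₁, hext₁⟩ := ih
    -- In matrix form the gradient step is Aᵀz + (I - AᵀA)v. The observation z is copied with
    -- threshold zero.
    obtain ⟨Φ', hΦ', hext⟩ := hΦ₁.exists_softThreshold hs (ι := Fin m ⊕ Fin q)
      (Sum.elim (fun i => Pi.single (Sum.inl i) 1) fun i => Sum.elim (fun l => A l i)
        fun i' => (Pi.single i 1 : Fin q → ℝ) i' - ∑ l, A l i * A l i')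
      (Sum.elim (fun _ => 0) fun _ => θ K)
    revert Φ'
    rw [hcard]
    intro Φ' hΦ' hext
    refine ⟨Φ', ?_, (hext₁.trans hext).mono (by omega) (le_of_eq (by ring))⟩
    convert hΦ' using 3 with y i
    rcases i with i | i
    · simp [softThreshold_zero_left, Pi.single_apply]
    · simp only [Sum.elim_inr, ista, Fintype.sum_sum_type, Sum.elim_inl]
      congr 1
      have h1 : ∑ i', ((Pi.single i 1 : Fin q → ℝ) i' - ∑ l, A l i * A l i') *
          ista A θ (f y) K i' = ista A θ (f y) K i -
            ∑ l, A l i * ∑ i', A l i' * ista A θ (f y) K i' := by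
        simp only [sub_mul, Finset.sum_sub_distrib, Pi.single_apply, ite_mul, one_mul, zero_mul,
          Finset.sum_ite_eq', Finset.mem_univ, if_true]
        congr 1
        simp_rw [Finset.mul_sum, Finset.sum_mul]
        rw [Finset.sum_comm]
        simp only [mul_assoc]
      rw [h1]
      simp only [mul_sub, Finset.sum_sub_distrib]
      ring

/-- A coordinatewise readable function can be attached as an output. -/
theorem Reads.exists_output {j : Fin J} {n : ℕ} (hs : 0 < s) {Φ : CNN s d j.castSucc 1 n}
    {f : (Fin (d 0) → ℝ) → Fin (d j.succ) → ℝ} (hf : Φ.Reads f) :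
    ∃ Φ' : CNN s d j.succ 1 n, Φ'.Reads f ∧
      (∀ y, Φ'.outputs y = Function.update (Φ.outputs y) j.succ (f y)) ∧
      Φ'.depth = Φ.depth + 1 ∧
      Φ'.numNonzeroWeights ≤ Φ.numNonzeroWeights + d j.succ * (n + 1) ∧
      Φ'.numWeights ≤ Φ.numWeights + s * (d j.succ * (n + 1)) := by
  obtain ⟨P, Q, hPQ⟩ := hf
  let V : Fin (d j.succ) → Fin n → ℝ := fun i c =>
    (if c = (P i).1 then 1 else 0) - (if c = (Q i).1 then 1 else 0)
  refine ⟨output j Φ (fun i c => Pi.single ⟨0, hs⟩ (V i c)) 0, ⟨P, Q, hPQ⟩, fun y => ?_, rfl,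
    ?_, ?_⟩
  · simp only [outputs]
    congr 1
    funext i
    simp only [convEntry_single, zero_mul, zeroExtend_of_lt _ one_pos, V, sub_mul,
      Finset.sum_sub_distrib, ite_mul, one_mul, Finset.sum_ite_eq', Finset.mem_univ, if_true,
      Pi.zero_apply, add_zero]
    rw [hPQ, Subsingleton.elim (P i).2 ⟨0, one_pos⟩, Subsingleton.elim (Q i).2 ⟨0, one_pos⟩]
  · have h1 := sum_hammingNorm_single_le (fun _ => (⟨0, hs⟩ : Fin s)) V
    simp only [numNonzeroWeights, hammingNorm_zero, add_zero]
    rw [mul_add]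
    omega
  · change Φ.numWeights + (d j.succ * n * s + d j.succ) ≤ _
    have : d j.succ ≤ s * d j.succ := Nat.le_mul_of_pos_left _ hs
    have h : s * (d j.succ * (n + 1)) = d j.succ * n * s + s * d j.succ := by ring
    omega

/-- `K` iterations of the thresholding algorithm, with the last iterate as output. -/
theorem Reads.exists_ista_output {j : Fin J} {n : ℕ} (hs : 0 < s) (hd : 0 < d j.succ)
    {Φ : CNN s d j.castSucc 1 n} (hn : n ≤ 4 * d j.castSucc)
    {f : (Fin (d 0) → ℝ) → Fin (d j.castSucc) → ℝ} (hf : Φ.Reads f)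
    (A : Matrix (Fin (d j.castSucc)) (Fin (d j.succ)) ℝ) (θ : ℕ → ℝ) (K : ℕ) :
    ∃ Φ' : CNN s d j.succ 1 (2 * d j.succ), Φ'.Reads (fun y => ista A θ (f y) K) ∧
      (∀ y, Φ'.outputs y = Function.update (Φ.outputs y) j.succ (ista A θ (f y) K)) ∧
      Φ'.depth ≤ Φ.depth + (K + 3) ∧
      Φ'.numNonzeroWeights ≤ Φ.numNonzeroWeights +
        (K + 3) * (10 * (d j.castSucc + d j.succ) ^ 2) ∧
      Φ'.numWeights ≤ Φ.numWeights +
        s * ((K + 3) * (10 * (d j.castSucc + d j.succ) ^ 2)) := by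
  obtain ⟨Φ₁, hΦ₁, hext₁⟩ := hf.exists_ista hs hd A θ K
  have : Nonempty (Fin (d j.succ)) := ⟨⟨0, hd⟩⟩
  -- This layer forgets the observation, so that the width is again controlled by the dimension of
  -- the current code alone, as the next stage requires. With it, the initial copy and the output,
  -- the stage has K + 3 layers.
  obtain ⟨Φ₂, hΦ₂, hext₂⟩ := hΦ₁.exists_softThreshold hs (ι := Fin (d j.succ))
    (fun i => Pi.single (Sum.inr i) 1) (fun _ => 0)
  revert Φ₂
  rw [Fintype.card_fin]
  intro Φ₂ hΦ₂ hext₂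
  have hΦ₂' : Φ₂.Reads (fun y => ista A θ (f y) K) := by
    convert hΦ₂ using 3 with y i
    simp [softThreshold_zero_left, Pi.single_apply]
  obtain ⟨Φ', hΦ', hout, hdepth, hnz, hw⟩ := hΦ₂'.exists_output hs
  have hext := hext₁.trans hext₂
  set a := d j.castSucc + d j.succ with ha
  have haa : a ≤ a ^ 2 := Nat.le_self_pow two_ne_zero _
  have key : ∀ {u v : ℕ}, u ≤ 2 * a → v ≤ 4 * a → u * (v + 1) ≤ 10 * a ^ 2 := by
    intro u v hu hv
    calc u * (v + 1) ≤ 2 * a * (4 * a + 1) := by gcongr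
      _ = 8 * a ^ 2 + 2 * a := by ring
      _ ≤ _ := by omega
  have h1 := key (u := 2 * a) (v := n) le_rfl (by omega)
  have h2 := key (u := 2 * a) (v := 2 * a) le_rfl (by omega)
  have h3 := key (u := 2 * d j.succ) (v := 2 * a) (by omega) (by omega)
  have h4 := key (u := d j.succ) (v := 2 * d j.succ) (by omega) (by omega)
  have h5 := Nat.mul_le_mul_left K h2
  have hX : 2 * a * (n + 1) + K * (2 * a * (2 * a + 1)) + 2 * d j.succ * (2 * a + 1) +
      d j.succ * (2 * d j.succ + 1) ≤ (K + 3) * (10 * a ^ 2) := by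
    rw [add_mul]; omega
  refine ⟨Φ', hΦ', fun y => by rw [hout, hext.outputs_eq], ?_, ?_, ?_⟩
  · have := hext.depth_le; omega
  · have := hext.nonzero_le; omega
  · have h6 := hext.weights_le
    have h7 := Nat.mul_le_mul_left s hX
    rw [mul_add s (_ + _)] at h7
    omega

end CNN
/-! ### The network for all layers of sparse codes -/

/-- The constants `E j` such that the codes of layer `j` are found within `E j * r ^ K` in `ℓ¹`. -/
noncomputable def codeErrorBound {J : ℕ} (d : Fin (J + 1) → ℕ) (lam : Fin J → ℝ) (B r : ℝ) :
    Fin (J + 1) → ℝ :=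
  Fin.induction 0 fun j e => d j.succ * |B| + 2 * lam j * e / (1 - r)

theorem codeErrorBound_zero {J : ℕ} (d : Fin (J + 1) → ℕ) (lam : Fin J → ℝ) (B r : ℝ) :
    codeErrorBound d lam B r 0 = 0 := rfl

theorem codeErrorBound_succ {J : ℕ} (d : Fin (J + 1) → ℕ) (lam : Fin J → ℝ) (B r : ℝ)
    (j : Fin J) : codeErrorBound d lam B r j.succ =
      d j.succ * |B| + 2 * lam j * codeErrorBound d lam B r j.castSucc / (1 - r) :=
  Fin.induction_succ ..

theorem codeErrorBound_nonneg {J : ℕ} (d : Fin (J + 1) → ℕ) {lam : Fin J → ℝ} (B : ℝ) {r : ℝ}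
    (hlam : ∀ j, 0 ≤ lam j) (hr : r < 1) (j : Fin (J + 1)) : 0 ≤ codeErrorBound d lam B r j := by
  have hr' : 0 < 1 - r := by linarith
  induction j using Fin.induction with
  | zero => exact le_rfl
  | succ j ih =>
    have := hlam j
    rw [codeErrorBound_succ]
    positivity

/-- One stage: from an approximation of the codes of one layer to those of the next. -/
theorem ista_error_of_approx {m n : ℕ} {A : Matrix (Fin m) (Fin n) ℝ} (hA : ColumnNormalized A)
    {lam B r E : ℝ} {K : ℕ} (hlam : 0 ≤ lam) (hq : contractionFactor A lam ≤ r) (hr : r < 1)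
    (hE : 0 ≤ E) {z x' : Fin m → ℝ} {x : Fin n → ℝ}
    (hfid : l2norm (x' - A.mulVec x) ≤ 0) (hsp : (hammingNorm x : ℝ) ≤ lam)
    (hB : ∀ i, |x i| ≤ B) (hz : ∑ l, |z l - x' l| ≤ E * r ^ K) :
    ∑ i, |ista A (istaThreshold A lam (E * r ^ K) (n * |B|)) z K i - x i| ≤
      (n * |B| + 2 * lam * E / (1 - r)) * r ^ K := by
  have hr0 : 0 ≤ r := (contractionFactor_nonneg A lam).trans hq
  have hδ : 0 ≤ E * r ^ K := by positivity
  have he : 0 ≤ (n : ℝ) * |B| := by positivity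
  have hx' : x' = A.mulVec x := sub_eq_zero.mp (l2norm_eq_zero hfid)
  have hx : ∑ i, |x i| ≤ n * |B| := by
    calc ∑ i, |x i| ≤ ∑ _i : Fin n, |B| :=
          Finset.sum_le_sum fun i _ => (hB i).trans (le_abs_self B)
      _ = _ := by simp
  -- The error of `z` is the noise, δ = E r^K. The initial error contracts by r^K, and the noise
  -- term is a multiple of r^K as well.
  refine (ista_error hA hδ hsp (by rw [hx'] at hz; exact hz) hx K).2.trans ?_
  refine (istaErrorBound_le (contractionFactor_nonneg A lam) hq hr hlam hδ he K).trans
    (le_of_eq ?_)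
  ring

theorem filter_castSucc_lt_succ {J : ℕ} (j : Fin J) :
    (Finset.univ.filter fun i : Fin J => i.castSucc < j.succ) =
      insert j (Finset.univ.filter fun i : Fin J => i.castSucc < j.castSucc) := by
  ext i
  simp only [Finset.mem_filter, Finset.mem_univ, true_and, Finset.mem_insert, Fin.lt_def,
    Fin.ext_iff, Fin.val_castSucc, Fin.val_succ]
  omega

section Network

variable {s J : ℕ} {d : Fin (J + 1) → ℕ}
  {D : ∀ j : Fin J, Matrix (Fin (d j.castSucc)) (Fin (d j.succ)) ℝ} {lam : Fin J → ℝ}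

/-- Induction over the stages. Besides the attached outputs, the last approximation `f` must remain
readable, since the next stage takes it as its observation. -/
theorem exists_network_upTo (hs : 2 ≤ s) (hd : ∀ j, 0 < d j) (hlam : ∀ j, 0 ≤ lam j)
    (hD : ∀ j, ColumnNormalized (D j)) {r : ℝ} (hr : r < 1)
    (hq : ∀ j, contractionFactor (D j) (lam j) ≤ r) (B : ℝ) (K : ℕ) :
    ∃ L : ℕ, s ^ L ≤ d 0 ∧ ∀ j : Fin (J + 1), ∃ (n : ℕ) (Φ : CNN s d j 1 n)
      (f : (Fin (d 0) → ℝ) → Fin (d j) → ℝ), n ≤ 4 * d j ∧ Φ.Reads f ∧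
      Φ.depth ≤ L + 1 + j * (K + 3) ∧
      Φ.numNonzeroWeights ≤ 40 * d 0 ^ 2 + ∑ i with Fin.castSucc i < j,
        (K + 3) * (10 * (d i.castSucc + d i.succ) ^ 2) ∧
      Φ.numWeights ≤ s * (40 * d 0 ^ 2 + ∑ i with Fin.castSucc i < j,
        (K + 3) * (10 * (d i.castSucc + d i.succ) ^ 2)) ∧
      ∀ (y : Fin (d 0) → ℝ) (x : ∀ j : Fin (J + 1), Fin (d j) → ℝ), IsDSCSolution D lam 0 y x →
        (∀ (j : Fin J) (i : Fin (d j.succ)), |x j.succ i| ≤ B) →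
        ∑ i, |f y i - x j i| ≤ codeErrorBound d lam B r j * r ^ K ∧
        ∀ i : Fin J, i.castSucc < j →
          l2norm (Φ.outputs y i.succ - x i.succ) ≤ codeErrorBound d lam B r i.succ * r ^ K := by
  have hs0 : 0 < s := by omega
  obtain ⟨L, n₀, Φ₀, hL, hn₀, hread₀, hdepth₀, hnz₀, hw₀⟩ := CNN.exists_gather (d := d) hs (hd 0)
  refine ⟨L, hL, fun j => ?_⟩
  induction j using Fin.induction with
  | zero =>
    refine ⟨n₀, Φ₀, _, hn₀, hread₀, by simpa using hdepth₀, by simpa using hnz₀,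
      by simpa using hw₀, fun y x hx _ => ⟨?_, fun i hi => absurd hi (Fin.not_lt_zero _)⟩⟩
    simp [hx.observation, codeErrorBound_zero]
  | succ j ih =>
    obtain ⟨n, Φ, f, hn, hread, hdepth, hnz, hw, happrox⟩ := ih
    -- The thresholds depend on K and on the a priori error bounds but not on `y`, so they can serve
    -- as biases.
    obtain ⟨Φ', hread', hout, hdepth', hnz', hw'⟩ := hread.exists_ista_output hs0 (hd j.succ) hn
      (D j) (istaThreshold (D j) (lam j) (codeErrorBound d lam B r j.castSucc * r ^ K)
        (d j.succ * |B|)) K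
    rw [filter_castSucc_lt_succ, Finset.sum_insert (by simp)]
    refine ⟨_, Φ', _, by omega, hread', ?_, ?_, ?_, fun y x hx hB => ?_⟩
    · rw [Fin.val_succ, add_mul, one_mul]
      rw [Fin.val_castSucc] at hdepth
      omega
    · omega
    · refine (hw'.trans (Nat.add_le_add_right hw _)).trans (le_of_eq ?_)
      ring
    · obtain ⟨h1, h2⟩ := happrox y x hx hB
      have h3 := ista_error_of_approx (hD j) (hlam j) (hq j) hr
        (codeErrorBound_nonneg d B hlam hr j.castSucc) (hx.fidelity j) (hx.sparsity j) (hB j) h1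
      rw [← codeErrorBound_succ] at h3
      refine ⟨h3, fun i hi => ?_⟩
      rw [hout]
      rcases eq_or_ne i j with rfl | hij
      · rw [Function.update_self]
        exact (l2norm_le_sum_abs _).trans h3
      · rw [Function.update_of_ne fun h => hij (Fin.succ_injective _ h)]
        refine h2 i ?_
        rw [Fin.lt_def, Fin.val_castSucc, Fin.val_castSucc]
        rw [Fin.lt_def, Fin.val_castSucc, Fin.val_succ] at hi
        have : (i : ℕ) ≠ j := fun h => hij (Fin.ext h)
        omega

/-- This turns the sum of the stages' costs into the product of the stated bounds. -/
theorem sum_le_prod_of_two_le {ι : Type*} (S : Finset ι) (a : ι → ℝ) (ha : ∀ i ∈ S, 2 ≤ a i) :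
    ∑ i ∈ S, a i ≤ ∏ i ∈ S, a i := by
  classical
  induction S using Finset.induction_on with
  | empty => simp
  | insert i S hi ih =>
    rw [Finset.sum_insert hi, Finset.prod_insert hi]
    have h1 := ha i (Finset.mem_insert_self i S)
    have h2 := ih fun k hk => ha k (Finset.mem_insert_of_mem hk)
    rcases S.eq_empty_or_nonempty with rfl | ⟨k, hk⟩
    · simp
    · have h3 : 2 ≤ ∑ i ∈ S, a i :=
        (ha k (Finset.mem_insert_of_mem hk)).trans
          (Finset.single_le_sum (f := a)
            (fun l hl => by linarith [ha l (Finset.mem_insert_of_mem hl)]) hk)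
      nlinarith

theorem logb_prod_max (hs : 2 ≤ s) (a : Fin J → ℝ) :
    Real.logb s (∏ j, max (s : ℝ) (a j)) = ∑ j, Real.logb s (max (s : ℝ) (a j)) := by
  have hs0 : (0 : ℝ) < s := by exact_mod_cast (by omega : 0 < s)
  exact Real.logb_prod _ _ fun j _ => (lt_max_of_lt_left hs0).ne'

/-- The network with `K` iterations per layer of codes. -/
theorem exists_network (hs : 2 ≤ s) (hd : ∀ j, 0 < d j) (hlam : ∀ j, 0 ≤ lam j)
    (hD : ∀ j, ColumnNormalized (D j)) {r : ℝ} (hr0 : 0 ≤ r) (hr : r < 1)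
    (hq : ∀ j, contractionFactor (D j) (lam j) ≤ r) (B : ℝ) {K : ℕ} (hK : 1 ≤ K) :
    ∃ (p n : ℕ) (Φ : CNN s d (Fin.last J) p n),
      (Φ.depth : ℝ) ≤ 80 * (K * Real.logb s
        (∏ j : Fin J, max (s : ℝ) ((d j.castSucc : ℝ) + d j.succ))) ∧
      (Φ.numNonzeroWeights : ℝ) ≤
        80 * (K * ∏ j : Fin J, ((d j.castSucc : ℝ) + d j.succ) ^ 2) ∧
      (Φ.numWeights : ℝ) ≤
        80 * s * (K * ∏ j : Fin J, ((d j.castSucc : ℝ) + d j.succ) ^ 2) ∧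
      ApproximatesCodes D lam B Φ ((1 + ∑ j, codeErrorBound d lam B r j) * r ^ K) := by
  -- For J = 0 the logarithm of the empty product is zero and no layer is allowed: the bare input
  -- serves.
  rcases J with _ | J
  · refine ⟨_, _, (CNN.input : CNN s d 0 (d 0) 1), ?_, ?_, ?_, fun y x _ _ j => j.elim0⟩
    · simp [CNN.depth]
    · simp [CNN.numNonzeroWeights]
    · simp only [CNN.numWeights, Nat.cast_zero]; positivity
  obtain ⟨L, hL, h⟩ := exists_network_upTo hs hd hlam hD hr hq B K
  obtain ⟨n, Φ, f, -, -, hdepth, hnz, hw, happrox⟩ := h (Fin.last (J + 1))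
  have hfilter : (Finset.univ.filter fun i : Fin (J + 1) => i.castSucc < Fin.last (J + 1)) =
      Finset.univ := by
    simp [Finset.filter_true_of_mem, Fin.castSucc_lt_last]
  rw [hfilter] at hnz hw
  have hs1 : (1 : ℝ) < s := by exact_mod_cast (by omega : 1 < s)
  have hK1 : (1 : ℝ) ≤ K := by exact_mod_cast hK
  have hsum : (40 * d 0 ^ 2 + ∑ i : Fin (J + 1),
      (K + 3) * (10 * (d i.castSucc + d i.succ) ^ 2) : ℕ) ≤
        80 * (K * ∏ j : Fin (J + 1), ((d j.castSucc : ℝ) + d j.succ) ^ 2) := by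
    have h1 : ∑ j : Fin (J + 1), ((d j.castSucc : ℝ) + d j.succ) ^ 2 ≤
        ∏ j : Fin (J + 1), ((d j.castSucc : ℝ) + d j.succ) ^ 2 := by
      refine sum_le_prod_of_two_le _ _ fun j _ => ?_
      have h1 : (1 : ℝ) ≤ d j.castSucc := by exact_mod_cast hd j.castSucc
      have h2 : (1 : ℝ) ≤ d j.succ := by exact_mod_cast hd j.succ
      nlinarith
    have h2 : (d 0 : ℝ) ^ 2 ≤ ∑ j : Fin (J + 1), ((d j.castSucc : ℝ) + d j.succ) ^ 2 := by
      refine le_trans ?_ (Finset.single_le_sum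
        (f := fun j : Fin (J + 1) => ((d j.castSucc : ℝ) + d j.succ) ^ 2)
        (fun j _ => by positivity) (Finset.mem_univ 0))
      have : (0 : ℝ) ≤ d (Fin.succ (0 : Fin (J + 1))) := Nat.cast_nonneg _
      rw [Fin.castSucc_zero]
      gcongr
      linarith
    push_cast
    rw [← Finset.mul_sum, ← Finset.mul_sum]
    set S := ∑ j : Fin (J + 1), ((d j.castSucc : ℝ) + d j.succ) ^ 2
    have hS : 0 ≤ S := le_trans (sq_nonneg _) h2
    -- Since K ≥ 1, K + 3 ≤ 4K; 80 = 40 + 4 · 10.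
    calc 40 * (d 0 : ℝ) ^ 2 + (K + 3) * (10 * S) ≤ 40 * (K * S) + (K + 3 * K) * (10 * S) := by
          gcongr
          · exact h2.trans (le_mul_of_one_le_left hS hK1)
          · linarith
      _ = 80 * (K * S) := by ring
      _ ≤ _ := by gcongr
  refine ⟨1, n, Φ, ?_, le_trans (by exact_mod_cast hnz) hsum, ?_, fun y x hx hB j => ?_⟩
  · rw [logb_prod_max hs]
    -- Because of the maximum with s every logarithm is at least one, so their sum also bounds the
    -- number of stages.
    have hone : ∀ j : Fin (J + 1),
        1 ≤ Real.logb s (max (s : ℝ) ((d j.castSucc : ℝ) + d j.succ)) := fun j => by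
      rw [Real.le_logb_iff_rpow_le hs1 (lt_max_of_lt_left (by linarith)), Real.rpow_one]
      exact le_max_left _ _
    set T := ∑ j : Fin (J + 1), Real.logb s (max (s : ℝ) ((d j.castSucc : ℝ) + d j.succ)) with hT
    have hJ : ((J + 1 : ℕ) : ℝ) ≤ T := by
      have := Finset.sum_le_sum fun (j : Fin (J + 1)) (_ : j ∈ Finset.univ) => hone j
      simpa using this
    have hLT : (L : ℝ) ≤ T := by
      refine le_trans ?_ (Finset.single_le_sum
        (f := fun j : Fin (J + 1) =>
          Real.logb s (max (s : ℝ) ((d j.castSucc : ℝ) + d j.succ)))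
        (fun j _ => by linarith [hone j]) (Finset.mem_univ 0))
      rw [Real.le_logb_iff_rpow_le hs1 (lt_max_of_lt_left (by linarith)), Real.rpow_natCast]
      refine le_max_of_le_right ?_
      have h1 : (s : ℝ) ^ L ≤ d 0 := by exact_mod_cast hL
      have : (0 : ℝ) ≤ d (Fin.succ (0 : Fin (J + 1))) := Nat.cast_nonneg _
      rw [Fin.castSucc_zero]
      linarith
    have hT1 : 1 ≤ T := le_trans (by push_cast; linarith [Nat.cast_nonneg (α := ℝ) J]) hJ
    have hdepth' : (Φ.depth : ℝ) ≤ L + 1 + ((J + 1 : ℕ) : ℝ) * (K + 3) := by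
      rw [Fin.val_last] at hdepth
      exact_mod_cast hdepth
    calc (Φ.depth : ℝ) ≤ L + 1 + ((J + 1 : ℕ) : ℝ) * (K + 3) := hdepth'
      _ ≤ T + T + T * (K + 3 * K) := by gcongr; linarith
      _ ≤ 80 * (K * T) := by nlinarith
  · calc (Φ.numWeights : ℝ) ≤ (s : ℝ) * (40 * d 0 ^ 2 + ∑ i : Fin (J + 1),
        (K + 3) * (10 * (d i.castSucc + d i.succ) ^ 2) : ℕ) := by exact_mod_cast hw
      _ ≤ s * (80 * (K * ∏ j : Fin (J + 1), ((d j.castSucc : ℝ) + d j.succ) ^ 2)) := by gcongr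
      _ = _ := by ring
  · refine ((happrox y x hx hB).2 j (Fin.castSucc_lt_last j)).trans ?_
    gcongr
    have := Finset.single_le_sum (f := codeErrorBound d lam B r)
      (fun i _ => codeErrorBound_nonneg d B hlam hr i) (Finset.mem_univ j.succ)
    linarith

end Network

/-! ### Constants and the number of iterations. -/

/-- For a ≥ 1 both s and a are at most s^a. The resulting bound is free of s, as the constant of the
second claim must be. -/
theorem logb_prod_max_le_sum {s J : ℕ} (hs : 2 ≤ s) (a : Fin J → ℕ) (ha : ∀ j, 1 ≤ a j) :
    Real.logb s (∏ j, max (s : ℝ) (a j)) ≤ ∑ j, (a j : ℝ) := by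
  have hs1 : (1 : ℝ) < s := by exact_mod_cast (by omega : 1 < s)
  rw [logb_prod_max hs]
  refine Finset.sum_le_sum fun j _ => ?_
  rw [Real.logb_le_iff_le_rpow hs1 (lt_max_of_lt_left (by linarith)), Real.rpow_natCast]
  refine max_le (le_self_pow₀ hs1.le (by have := ha j; omega)) ?_
  exact_mod_cast (Nat.lt_pow_self (by omega : 1 < s)).le

/-- Finitely many contraction factors are bounded away from one. -/
theorem exists_contraction_bound {J : ℕ} (q : Fin J → ℝ) (hq : ∀ j, q j < 1) :
    ∃ r, 0 < r ∧ r < 1 ∧ ∀ j, q j ≤ r := by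
  obtain ⟨r, hr, hr'⟩ : ∃ r < (1 : ℝ), ∀ j, q j ≤ r := by
    rcases isEmpty_or_nonempty (Fin J) with _ | _
    · exact ⟨0, one_pos, fun j => isEmptyElim j⟩
    · obtain ⟨j₀, h⟩ := Finite.exists_max q
      exact ⟨q j₀, hq j₀, h⟩
  -- The maximum with 1/2 keeps the rate positive, so that its logarithm can define c.
  exact ⟨max r (1 / 2), lt_max_of_lt_right (by norm_num), max_lt hr (by norm_num),
    fun j => le_max_of_le_left (hr' j)⟩

/-- The number of iterations after which a geometrically decreasing error is at most `ε`. -/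
theorem exists_iterations {c C ε : ℝ} (hc : 0 < c) (hC : 0 < C) (hε : 0 < ε) (hε' : ε ≤ 1 / 2) :
    ∃ K : ℕ, 1 ≤ K ∧ (K : ℝ) ≤ ((|Real.log C| + 1) / c + 2) * |Real.logb 2 ε| ∧
      C * Real.exp (-(c * K)) ≤ ε := by
  have hlog2 : 0 < Real.log 2 := Real.log_pos one_lt_two
  have hlog2' : Real.log 2 ≤ 1 := by linarith [Real.log_two_lt_d9]
  have hlogε : Real.log ε ≤ -Real.log 2 := by
    rw [← Real.log_inv]
    exact Real.log_le_log hε (by linarith)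
  set ℓ := |Real.logb 2 ε| with hℓ
  have hℓ' : ℓ * Real.log 2 = -Real.log ε := by
    rw [hℓ, Real.logb, abs_div, abs_of_pos hlog2, div_mul_cancel₀ _ hlog2.ne',
      abs_of_neg (by linarith)]
  have hℓ1 : 1 ≤ ℓ := by
    by_contra hlt
    push Not at hlt
    nlinarith
  have hℓlog : -Real.log ε ≤ ℓ := by rw [← hℓ']; nlinarith
  -- At K = x the error is already at most ε, because ℓ ≥ -log ε. Rounding up and adding one costs
  -- at most 2 ≤ 2ℓ.
  set x := (|Real.log C| + ℓ) / c with hx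
  have hx0 : 0 ≤ x := by positivity
  refine ⟨⌈x⌉₊ + 1, by omega, ?_, ?_⟩
  · have h1 := (Nat.ceil_lt_add_one hx0).le
    have h2 : x ≤ (|Real.log C| + 1) / c * ℓ := by
      rw [hx, div_mul_eq_mul_div]
      gcongr
      nlinarith [abs_nonneg (Real.log C)]
    push_cast
    linarith
  · have h1 : x ≤ ⌈x⌉₊ := Nat.le_ceil x
    have h2 : c * x = |Real.log C| + ℓ := by rw [hx]; field_simp
    have h3 : c * x ≤ c * (⌈x⌉₊ + 1 : ℕ) := by
      push_cast; gcongr; linarith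
    rw [← Real.log_le_log_iff (by positivity) hε, Real.log_mul hC.ne' (Real.exp_ne_zero _),
      Real.log_exp]
    linarith [le_abs_self (Real.log C)]

theorem mainTheorem7 :
    ∃ A : ℝ, 0 < A ∧
      ∀ (J : ℕ) (d : Fin (J + 1) → ℕ)
        (D : ∀ j : Fin J, Matrix (Fin (d j.castSucc)) (Fin (d j.succ)) ℝ) (lam : Fin J → ℝ),
        (∀ j, 0 < d j) → (∀ j, 0 ≤ lam j) → (∀ j, ColumnNormalized (D j)) →
        (∀ j, SparsityCondition (D j) (lam j)) →
        ∃ c : ℝ, 0 < c ∧ ∀ B : ℝ, ∃ C : ℝ, 0 < C ∧ ∃ C' : ℝ, 0 < C' ∧ ∀ s : ℕ, 2 ≤ s →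
          (∀ K : ℕ, 1 ≤ K → ∃ (p n : ℕ) (Φ : CNN s d (Fin.last J) p n),
            (Φ.depth : ℝ) ≤ A * (K * Real.logb s
              (∏ j : Fin J, max (s : ℝ) ((d j.castSucc : ℝ) + d j.succ))) ∧
            (Φ.numNonzeroWeights : ℝ) ≤
              A * (K * ∏ j : Fin J, ((d j.castSucc : ℝ) + d j.succ) ^ 2) ∧
            (Φ.numWeights : ℝ) ≤
              A * s * (K * ∏ j : Fin J, ((d j.castSucc : ℝ) + d j.succ) ^ 2) ∧
            ApproximatesCodes D lam B Φ (C * Real.exp (-(c * K)))) ∧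
          (∀ ε : ℝ, 0 < ε → ε ≤ 1 / 2 → ∃ (p n : ℕ) (Φ : CNN s d (Fin.last J) p n),
            (Φ.depth : ℝ) ≤ C' * |Real.logb 2 ε| ∧ ApproximatesCodes D lam B Φ ε) := by
  refine ⟨80, by norm_num, fun J d D lam hd hlam hD hsparse => ?_⟩
  obtain ⟨r, hr0, hr, hq⟩ := exists_contraction_bound
    (fun j => contractionFactor (D j) (lam j)) fun j => (hsparse j).contractionFactor_lt_one
  refine ⟨-Real.log r, neg_pos.mpr (Real.log_neg hr0 hr), fun B => ?_⟩
  have hC : 0 < 1 + ∑ j, codeErrorBound d lam B r j :=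
    add_pos_of_pos_of_nonneg one_pos
      (Finset.sum_nonneg fun j _ => codeErrorBound_nonneg d B hlam hr j)
  set C := 1 + ∑ j, codeErrorBound d lam B r j
  set c := -Real.log r with hc
  have hc0 : 0 < c := neg_pos.mpr (Real.log_neg hr0 hr)
  have hexp : ∀ K : ℕ, Real.exp (-(c * K)) = r ^ K := fun K => by
    rw [hc, neg_mul, neg_neg, mul_comm, Real.exp_nat_mul, Real.exp_log hr0]
  set S : ℝ := ∑ j : Fin J, ((d j.castSucc + d j.succ : ℕ) : ℝ)
  have hS : 0 ≤ S := Finset.sum_nonneg fun j _ => Nat.cast_nonneg _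
  -- `S` vanishes for J = 0; `S + 1` keeps the constant positive.
  have hC' : 0 < 80 * (((|Real.log C| + 1) / c + 2) * (S + 1)) := by positivity
  refine ⟨C, hC, _, hC', fun s hs => ?_⟩
  have hnet := fun (K : ℕ) (hK : 1 ≤ K) => exists_network hs hd hlam hD hr0.le hr hq B hK
  refine ⟨fun K hK => by simpa only [hexp] using hnet K hK, fun ε hε hε' => ?_⟩
  obtain ⟨K, hK, hKle, herr⟩ := exists_iterations hc0 hC hε hε'
  obtain ⟨p, n, Φ, hdepth, -, -, happrox⟩ := hnet K hK
  rw [hexp] at herr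
  refine ⟨p, n, Φ, hdepth.trans ?_, fun y x hx hB j => (happrox y x hx hB j).trans herr⟩
  have hlog := logb_prod_max_le_sum hs (fun j : Fin J => d j.castSucc + d j.succ)
    fun j => Nat.le_add_right_of_le (hd j.castSucc)
  simp only [Nat.cast_add] at hlog
  calc 80 * (K * Real.logb s (∏ j : Fin J, max (s : ℝ) ((d j.castSucc : ℝ) + d j.succ)))
      ≤ 80 * (K * (S + 1)) := by
        gcongr
        refine hlog.trans ?_
        simp only [S, Nat.cast_add]
        linarith
    _ ≤ 80 * (((|Real.log C| + 1) / c + 2) * |Real.logb 2 ε| * (S + 1)) := by gcongr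
    _ = _ := by ring
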